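/- Let $n,m,s\ge 0$ and $N\ge 0$ be integers. For $0\le k<N$ let $A_k\in\mathbb R^{n\times n}$, $B_k\in\mathbb R^{n\times m}$, $C_k\in\mathbb R^{s\times n}$ and let $R_k\in\mathbb R^{m\times m}$ be symmetric positive definite; for $0\le k\le N$ let $Q_k\in\mathbb R^{n\times n}$ be symmetric positive definite and let $\bar x_k\in\mathbb R^n$ be a given (deterministic) reference. (The time-invariant case is $A_k=A$, $B_k=B$.) On a probability space let $x_0$, $w_0,\dots,w_{N-1}$ (with values in $\mathbb R^n$) and $v_0,\dots,v_{N-1}$ (with values in $\mathbb R^s$) be random vectors such that: $x_0$ and all $w_k$ have finite second moments; $E\,w_k=0$; the $w_k$ are mutually independent and $(w_0,\dots,w_{N-1})$ is independent of $x_0$; the $v_k$ are mutually independent and $(v_0,\dots,v_{N-1})$ is independent of $(x_0,w_0,\dots,w_{N-1})$. No Gaussianity is assumed, and no moment of $v_k$ is assumed to exist. An admissible policy is a sequence $\pi=(\mu_0,\dots,\mu_{N-1})$ of measurable functions, where $\mu_k$ maps the information vector $I_k=(z_0,\dots,z_k,u_0,\dots,u_{k-1})$ to $\mathbb R^m$.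 It generates the closed-loop processes $$z_k=C_kx_k+v_k,\qquad u_k=\mu_k(I_k),\qquad x_{k+1}=A_kx_k+B_ku_k+w_k,\qquad 0\le k<N,$$ and has the cost $$J_\pi=E\Big\{(x_N-\bar x_N)^TQ_N(x_N-\bar x_N)+\sum_{k=0}^{N-1}\big((x_k-\bar x_k)^TQ_k(x_k-\bar x_k)+u_k^TR_ku_k\big)\Big\}\in[0,\infty].$$ A policy is optimal if it is admissible and minimizes $J_\pi$ over all admissible policies. Define backwards in time $K_N=Q_N$, $g_N=-Q_N\bar x_N$ and, for $k=N-1,\dots,0$, $$P_k=A_k^TK_{k+1}^TB_k\big(B_k^TK_{k+1}B_k+R_k\big)^{-1}B_k^TK_{k+1}A_k,\qquad K_k=A_k^TK_{k+1}A_k-P_k+Q_k,$$ $$g_k=A_k^T\big[I-K_{k+1}B_k\big(R_k+B_k^TK_{k+1}B_k\big)^{-1}B_k^T\big]g_{k+1}-Q_k\bar x_k .$$ Then: 1. $R_k+B_k^TK_{k+1}B_k$ is positive definite (so the inverses exist) for all $0\le k<N$. 2. An optimal policy exists, and its cost is finite. 3. An admissible policy is optimal if and only if the controls and states that it generates satisfy,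 almost surely, for every $0\le k<N$, $$u_k=-\big(R_k+B_k^TK_{k+1}B_k\big)^{-1}B_k^T\big(K_{k+1}A_k\,E[x_k\mid I_k]+g_{k+1}\big).$$ -/

import Mathlib

open MeasureTheory ProbabilityTheory
open scoped Matrix ENNReal

namespace LQGTracking

/-- Deterministic data of a finite-horizon linear quadratic tracking problem with `N` stages, state
space `ℝⁿ`, control space `ℝᵐ` and observation space `ℝˢ`. Only the entries at the stages
`0, …, N - 1` (and `0, …, N` for `Q` and the reference `xref`) play a role. -/
structure Data (n m s : ℕ) where
  N : ℕ
  A : ℕ → Matrix (Fin n) (Fin n) ℝ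
  B : ℕ → Matrix (Fin n) (Fin m) ℝ
  C : ℕ → Matrix (Fin s) (Fin n) ℝ
  Q : ℕ → Matrix (Fin n) (Fin n) ℝ
  R : ℕ → Matrix (Fin m) (Fin m) ℝ
  xref : ℕ → Fin n → ℝ

/-- The information vector `I_k = (z_0, …, z_k, u_0, …, u_{k-1})`. -/
abbrev Info (m s k : ℕ) : Type :=
  (Fin (k + 1) → Fin s → ℝ) × (Fin k → Fin m → ℝ)

/-- A policy: a function `μ_k` of the information vector `I_k` for each stage `k`. -/
abbrev Policy (m s : ℕ) : Type :=
  (k : ℕ) → Info m s k → Fin m → ℝ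

variable {n m s : ℕ}

/-- The pair `(x_k, I_k)` generated by the policy `p` along one realisation of the initial state
`x0`, the process noise `w` and the observation noise `v`: `z_k = C_k x_k + v_k`,
`u_k = μ_k(I_k)`, `x_{k+1} = A_k x_k + B_k u_k + w_k` and `I_{k+1} = (I_k, z_{k+1}, u_k)`. -/
def closedLoop (D : Data n m s) (p : Policy m s) (x0 : Fin n → ℝ) (w : ℕ → Fin n → ℝ)
    (v : ℕ → Fin s → ℝ) : (k : ℕ) → (Fin n → ℝ) × Info m s k
  | 0 => (x0, (fun _ => D.C 0 *ᵥ x0 + v 0, Fin.elim0))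
  | k + 1 =>
    let x := (closedLoop D p x0 w v k).1
    let I := (closedLoop D p x0 w v k).2
    let u := p k I
    let x' := D.A k *ᵥ x + D.B k *ᵥ u + w k
    (x', (Fin.snoc (α := fun _ => Fin s → ℝ) I.1 (D.C (k + 1) *ᵥ x' + v (k + 1)),
      Fin.snoc (α := fun _ => Fin m → ℝ) I.2 u))

section Processes

variable {Ω : Type*} (D : Data n m s) (x0 : Ω → Fin n → ℝ) (w : ℕ → Ω → Fin n → ℝ)
  (v : ℕ → Ω → Fin s → ℝ) (p : Policy m s)

/-- The state process `x_k` under the policy `p`. -/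
def state (k : ℕ) (ω : Ω) : Fin n → ℝ :=
  (closedLoop D p (x0 ω) (fun j => w j ω) (fun j => v j ω) k).1

/-- The information process `I_k` under the policy `p`. -/
def info (k : ℕ) (ω : Ω) : Info m s k :=
  (closedLoop D p (x0 ω) (fun j => w j ω) (fun j => v j ω) k).2

/-- The control process `u_k = μ_k(I_k)` under the policy `p`. -/
def control (k : ℕ) (ω : Ω) : Fin m → ℝ :=
  p k (info D x0 w v p k ω)

/-- The σ-algebra generated by the information vector `I_k` under the policy `p`. -/
abbrev infoSigma (k : ℕ) : MeasurableSpace Ω :=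
  MeasurableSpace.comap (info D x0 w v p k) inferInstance

/-- The realised quadratic cost
`(x_N - x̄_N)ᵀ Q_N (x_N - x̄_N) + ∑_{k<N} ((x_k - x̄_k)ᵀ Q_k (x_k - x̄_k) + u_kᵀ R_k u_k)`. -/
def pathCost (ω : Ω) : ℝ :=
  (state D x0 w v p D.N ω - D.xref D.N) ⬝ᵥ
      (D.Q D.N *ᵥ (state D x0 w v p D.N ω - D.xref D.N)) +
    ∑ k ∈ Finset.range D.N,
      ((state D x0 w v p k ω - D.xref k) ⬝ᵥ (D.Q k *ᵥ (state D x0 w v p k ω - D.xref k)) +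
        control D x0 w v p k ω ⬝ᵥ (D.R k *ᵥ control D x0 w v p k ω))

/-- The expected cost `J_π`, with value `∞` allowed. For positive definite weights the realised
cost is nonnegative, so that truncation at `0` by `ENNReal.ofReal` has no effect. -/
noncomputable def cost [MeasurableSpace Ω] (μ : Measure Ω) : ℝ≥0∞ :=
  ∫⁻ ω, ENNReal.ofReal (pathCost D x0 w v p ω) ∂μ

end Processes

/-- Admissible policies: the controls are arbitrary measurable functions of the information. -/
def Admissible (N : ℕ) (p : Policy m s) : Prop :=
  ∀ k < N, Measurable (p k)

/-- An optimal policy: it minimises the expected cost among all admissible policies. -/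
def IsOptimal {Ω : Type*} [MeasurableSpace Ω] (D : Data n m s) (x0 : Ω → Fin n → ℝ)
    (w : ℕ → Ω → Fin n → ℝ) (v : ℕ → Ω → Fin s → ℝ) (μ : Measure Ω) (p : Policy m s) : Prop :=
  Admissible D.N p ∧
    ∀ q : Policy m s, Admissible D.N q → cost D x0 w v p μ ≤ cost D x0 w v q μ

/-- `P = Aᵀ Kᵀ B (Bᵀ K B + R)⁻¹ Bᵀ K A` at stage `k`, where `K` stands for `K_{k+1}`. -/
noncomputable def riccatiP (D : Data n m s) (k : ℕ) (K : Matrix (Fin n) (Fin n) ℝ) :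
    Matrix (Fin n) (Fin n) ℝ :=
  (D.A k)ᵀ * Kᵀ * D.B k * ((D.B k)ᵀ * K * D.B k + D.R k)⁻¹ * (D.B k)ᵀ * K * D.A k

/-- `K_{N-j}`, computed backwards from `K_N = Q_N`. -/
noncomputable def riccatiBack (D : Data n m s) : ℕ → Matrix (Fin n) (Fin n) ℝ
  | 0 => D.Q D.N
  | j + 1 =>
    (D.A (D.N - (j + 1)))ᵀ * riccatiBack D j * D.A (D.N - (j + 1))
      - riccatiP D (D.N - (j + 1)) (riccatiBack D j) + D.Q (D.N - (j + 1))

/-- The matrix `K_k` (for `k ≤ N`). -/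
noncomputable def K (D : Data n m s) (k : ℕ) : Matrix (Fin n) (Fin n) ℝ :=
  riccatiBack D (D.N - k)

/-- The matrix `P_k = A_kᵀ K_{k+1}ᵀ B_k (B_kᵀ K_{k+1} B_k + R_k)⁻¹ B_kᵀ K_{k+1} A_k`. -/
noncomputable def P (D : Data n m s) (k : ℕ) : Matrix (Fin n) (Fin n) ℝ :=
  riccatiP D k (K D (k + 1))

/-- `g_{N-j}`, computed backwards from `g_N = -Q_N x̄_N`. -/
noncomputable def offsetBack (D : Data n m s) : ℕ → Fin n → ℝ
  | 0 => -(D.Q D.N *ᵥ D.xref D.N)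
  | j + 1 =>
    let k := D.N - (j + 1)
    ((D.A k)ᵀ * (1 - K D (k + 1) * D.B k *
        (D.R k + (D.B k)ᵀ * K D (k + 1) * D.B k)⁻¹ * (D.B k)ᵀ)) *ᵥ offsetBack D j
      - D.Q k *ᵥ D.xref k

/-- The offset `g_k` (for `k ≤ N`). -/
noncomputable def g (D : Data n m s) (k : ℕ) : Fin n → ℝ :=
  offsetBack D (D.N - k)

theorem K_last (D : Data n m s) : K D D.N = D.Q D.N := by
  simp [K, riccatiBack]

theorem K_step (D : Data n m s) {k : ℕ} (hk : k < D.N) :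
    K D k = (D.A k)ᵀ * K D (k + 1) * D.A k - P D k + D.Q k := by
  obtain ⟨j, hj⟩ : ∃ j, D.N - k = j + 1 := ⟨D.N - k - 1, by omega⟩
  have h1 : D.N - (k + 1) = j := by omega
  have h2 : D.N - (j + 1) = k := by omega
  simp only [K, P, hj, h1, riccatiBack, h2]

theorem g_last (D : Data n m s) : g D D.N = -(D.Q D.N *ᵥ D.xref D.N) := by
  simp [g, offsetBack]

theorem g_step (D : Data n m s) {k : ℕ} (hk : k < D.N) :
    g D k = ((D.A k)ᵀ * (1 - K D (k + 1) * D.B k *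
        (D.R k + (D.B k)ᵀ * K D (k + 1) * D.B k)⁻¹ * (D.B k)ᵀ)) *ᵥ g D (k + 1)
      - D.Q k *ᵥ D.xref k := by
  obtain ⟨j, hj⟩ : ∃ j, D.N - k = j + 1 := ⟨D.N - k - 1, by omega⟩
  have h1 : D.N - (k + 1) = j := by omega
  have h2 : D.N - (j + 1) = k := by omega
  simp only [g, hj, h1, offsetBack, h2]

/-- The control `-(R_k + B_kᵀ K_{k+1} B_k)⁻¹ B_kᵀ (K_{k+1} A_k y + g_{k+1})` for the state
estimate `y`. -/
noncomputable def feedback (D : Data n m s) (k : ℕ) (y : Fin n → ℝ) : Fin m → ℝ :=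
  -((D.R k + (D.B k)ᵀ * K D (k + 1) * D.B k)⁻¹ *ᵥ
    ((D.B k)ᵀ *ᵥ (K D (k + 1) *ᵥ (D.A k *ᵥ y) + g D (k + 1))))

end LQGTracking

namespace LQGTracking

/-! ### Quadratic forms and completion of the square. -/

variable {n m s : ℕ}

/-! Dynamic programming is carried out pathwise, before any expectation is taken. Completing the
square in `u_k` gives `stage_identity`: the running cost plus `costToGo` at stage `k + 1` equals
`costToGo` at stage `k`, plus a constant, plus the square of `u_k - feedback(x_k)` weighted by
`controlWeight`, plus terms in `w_k`. Summed along a trajectory this is `pathCost_eq`. In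
expectation the term linear in `w_k` vanishes, because `w_k` is centred and independent of `(x_k,
u_k)` (`IsNoise.indepFun_w`).

The feedback at `x_k` is not available to the controller. Since `feedback` is affine, `u_k -
feedback(x_k)` is the deviation of `u_k` from the feedback at `E[x_k | I_k]` plus `gain` times the
estimation error. The deviation is a function of `I_k` and the error is orthogonal to such
functions, so the expected square splits in two (`IsNoise.integral_control_sub_feedback`). Controls
shift the state and the observations by amounts that can be computed from `I_k`; hence neither the
information σ-algebra (`infoSigma_eq`) nor the error (`IsNoise.state_sub_condExp`) depends on the
policy.

Thus the cost is `baseCost` plus the sum of the `stageExcess`, which are nonnegative and vanish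
exactly when the feedback law holds almost surely. Two points remain: a finite cost forces
square-integrable controls, because `R_k` is positive definite, and the feedback law, whose estimate
refers to the policy itself, is realised by an actual policy (`IsNoise.exists_feedback_policy`). -/

theorem dotProduct_transpose_mulVec {ι κ : Type*} [Fintype ι] [Fintype κ]
    (A : Matrix κ ι ℝ) (x : ι → ℝ) (y : κ → ℝ) : x ⬝ᵥ (Aᵀ *ᵥ y) = (A *ᵥ x) ⬝ᵥ y := by
  rw [Matrix.mulVec_transpose, dotProduct_comm, ← Matrix.dotProduct_mulVec, dotProduct_comm]

theorem dotProduct_mulVec_comm_of_symm {ι : Type*} [Fintype ι] {S : Matrix ι ι ℝ} (hS : Sᵀ = S)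
    (x y : ι → ℝ) : x ⬝ᵥ (S *ᵥ y) = y ⬝ᵥ (S *ᵥ x) := by
  conv_lhs => rw [← hS]
  rw [dotProduct_transpose_mulVec, dotProduct_comm]

theorem transpose_eq_of_posDef {ι : Type*} [Fintype ι] {S : Matrix ι ι ℝ} (hS : S.PosDef) :
    Sᵀ = S := by
  simpa [Matrix.conjTranspose_eq_transpose_of_trivial] using hS.isHermitian.eq

theorem mulVec_inv_mulVec_of_posDef {ι : Type*} [Fintype ι] [DecidableEq ι] {S : Matrix ι ι ℝ}
    (hS : S.PosDef) (y : ι → ℝ) : S *ᵥ (S⁻¹ *ᵥ y) = y := by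
  rw [Matrix.mulVec_mulVec, Matrix.mul_nonsing_inv _ ((Matrix.isUnit_iff_isUnit_det _).1 hS.isUnit),
    Matrix.one_mulVec]

/-- The quadratic form of `S` at a sum of two vectors. -/
theorem quadForm_add {ι : Type*} [Fintype ι] {S : Matrix ι ι ℝ} (hS : Sᵀ = S) (x y : ι → ℝ) :
    (x + y) ⬝ᵥ (S *ᵥ (x + y)) = x ⬝ᵥ (S *ᵥ x) + 2 * ((S *ᵥ x) ⬝ᵥ y) + y ⬝ᵥ (S *ᵥ y) := by
  rw [Matrix.mulVec_add, add_dotProduct, dotProduct_add, dotProduct_add,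
    dotProduct_mulVec_comm_of_symm hS x y, dotProduct_comm (S *ᵥ x) y]
  ring

/-- Completion of the square in the control variable. -/
theorem complete_square {R : Matrix (Fin m) (Fin m) ℝ} {K : Matrix (Fin n) (Fin n) ℝ}
    (B : Matrix (Fin n) (Fin m) ℝ) (hK : Kᵀ = K) (hM : (R + Bᵀ * K * B).PosDef)
    (y g : Fin n → ℝ) (u : Fin m → ℝ) :
    u ⬝ᵥ (R *ᵥ u) + (y + B *ᵥ u) ⬝ᵥ (K *ᵥ (y + B *ᵥ u)) + 2 * (g ⬝ᵥ (y + B *ᵥ u)) =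
      (u + (R + Bᵀ * K * B)⁻¹ *ᵥ (Bᵀ *ᵥ (K *ᵥ y + g))) ⬝ᵥ
        ((R + Bᵀ * K * B) *ᵥ (u + (R + Bᵀ * K * B)⁻¹ *ᵥ (Bᵀ *ᵥ (K *ᵥ y + g)))) +
      (y ⬝ᵥ (K *ᵥ y) + 2 * (g ⬝ᵥ y) -
        (Bᵀ *ᵥ (K *ᵥ y + g)) ⬝ᵥ ((R + Bᵀ * K * B)⁻¹ *ᵥ (Bᵀ *ᵥ (K *ᵥ y + g)))) := by
  have hu : u ⬝ᵥ ((R + Bᵀ * K * B) *ᵥ u) = u ⬝ᵥ (R *ᵥ u) + (B *ᵥ u) ⬝ᵥ (K *ᵥ (B *ᵥ u)) := by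
    rw [Matrix.add_mulVec, dotProduct_add, ← Matrix.mulVec_mulVec, ← Matrix.mulVec_mulVec,
      dotProduct_transpose_mulVec]
  have hh : u ⬝ᵥ (Bᵀ *ᵥ (K *ᵥ y + g)) = (K *ᵥ y) ⬝ᵥ (B *ᵥ u) + g ⬝ᵥ (B *ᵥ u) := by
    rw [dotProduct_transpose_mulVec, dotProduct_add, dotProduct_comm, dotProduct_comm (B *ᵥ u) g]
  rw [quadForm_add (transpose_eq_of_posDef hM), quadForm_add hK, mulVec_inv_mulVec_of_posDef hM,
    hu, dotProduct_comm ((R + Bᵀ * K * B) *ᵥ u), dotProduct_mulVec_comm_of_symm (transpose_eq_of_posDef hM) _ u,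
    mulVec_inv_mulVec_of_posDef hM, hh, dotProduct_add g, dotProduct_comm (_⁻¹ *ᵥ _)]
  ring

/-! ### The Riccati recursion and the one-stage identity. -/

variable (D : Data n m s)

/-- The matrix `R_k + B_kᵀ K_{k+1} B_k`. -/
noncomputable abbrev controlWeight (k : ℕ) : Matrix (Fin m) (Fin m) ℝ :=
  D.R k + (D.B k)ᵀ * K D (k + 1) * D.B k

/-- The optimal-cost-to-go function `x ↦ xᵀ K_k x + 2 g_kᵀ x`, up to a constant. -/
noncomputable def costToGo (k : ℕ) (x : Fin n → ℝ) : ℝ :=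
  x ⬝ᵥ (K D k *ᵥ x) + 2 * (g D k ⬝ᵥ x)

/-- The constant term in the dynamic programming step at stage `k`. -/
noncomputable def stageConst (k : ℕ) : ℝ :=
  D.xref k ⬝ᵥ (D.Q k *ᵥ D.xref k) -
    ((D.B k)ᵀ *ᵥ g D (k + 1)) ⬝ᵥ ((controlWeight D k)⁻¹ *ᵥ ((D.B k)ᵀ *ᵥ g D (k + 1)))

/-- Symmetry of `K_{k+1}` turns the form of `P_k` into `hᵀ M⁻¹ h` with `h = Bᵀ K A x` and `M` the
control weight, which is the term subtracted in `complete_square`. -/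
theorem quadForm_K_step {k : ℕ} (hk : k < D.N) (hK : (K D (k + 1))ᵀ = K D (k + 1))
    (x : Fin n → ℝ) :
    x ⬝ᵥ (K D k *ᵥ x) = (D.A k *ᵥ x) ⬝ᵥ (K D (k + 1) *ᵥ (D.A k *ᵥ x)) -
      ((D.B k)ᵀ *ᵥ (K D (k + 1) *ᵥ (D.A k *ᵥ x))) ⬝ᵥ ((controlWeight D k)⁻¹ *ᵥ
        ((D.B k)ᵀ *ᵥ (K D (k + 1) *ᵥ (D.A k *ᵥ x)))) + x ⬝ᵥ (D.Q k *ᵥ x) := by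
  rw [K_step D hk, P, riccatiP, hK, Matrix.add_mulVec, Matrix.sub_mulVec, dotProduct_add,
    dotProduct_sub, add_comm _ (D.R k)]
  simp only [← Matrix.mulVec_mulVec]
  rw [dotProduct_transpose_mulVec, dotProduct_transpose_mulVec,
    ← dotProduct_mulVec_comm_of_symm hK, dotProduct_comm _ (K D (k + 1) *ᵥ _),
    ← dotProduct_transpose_mulVec (D.B k)ᵀ, Matrix.transpose_transpose,
    dotProduct_mulVec_comm_of_symm hK, dotProduct_comm _ (K D (k + 1) *ᵥ _)]

/-- The middle term is the mixed part of `(h + Bᵀ g)ᵀ M⁻¹ (h + Bᵀ g)` with `h = Bᵀ K A x`; the pure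
parts go into `K_k` and `stageConst`. -/
theorem dotProduct_g_step {k : ℕ} (hk : k < D.N) (hK : (K D (k + 1))ᵀ = K D (k + 1))
    (x : Fin n → ℝ) :
    g D k ⬝ᵥ x = g D (k + 1) ⬝ᵥ (D.A k *ᵥ x) -
      ((D.B k)ᵀ *ᵥ (K D (k + 1) *ᵥ (D.A k *ᵥ x))) ⬝ᵥ ((controlWeight D k)⁻¹ *ᵥ
        ((D.B k)ᵀ *ᵥ g D (k + 1))) - x ⬝ᵥ (D.Q k *ᵥ D.xref k) := by
  rw [dotProduct_comm, g_step D hk, dotProduct_sub, ← Matrix.mulVec_mulVec,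
    dotProduct_transpose_mulVec, Matrix.sub_mulVec, dotProduct_sub, Matrix.one_mulVec,
    dotProduct_comm (D.A k *ᵥ x)]
  simp only [← Matrix.mulVec_mulVec]
  rw [dotProduct_mulVec_comm_of_symm hK, dotProduct_comm _ (K D (k + 1) *ᵥ _),
    ← dotProduct_transpose_mulVec (D.B k)ᵀ, Matrix.transpose_transpose]

theorem posDef_controlWeight_of_posDef {k : ℕ} (hR : (D.R k).PosDef)
    (hK : (K D (k + 1)).PosDef) : (controlWeight D k).PosDef := by
  refine hR.add_posSemidef ?_
  simpa [Matrix.conjTranspose_eq_transpose_of_trivial] using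
    hK.posSemidef.conjTranspose_mul_mul_same (D.B k)

/-- Apart from `xᵀ Q x`, the form of `K_k` is the minimum over `u` of `uᵀ R u + (A x + B u)ᵀ K_{k+1}
(A x + B u)`, hence nonnegative; `Q_k` makes the sum strictly positive. -/
theorem posDef_K_of_succ {k : ℕ} (hk : k < D.N) (hQ : (D.Q k).PosDef) (hR : (D.R k).PosDef)
    (hK : (K D (k + 1)).PosDef) : (K D k).PosDef := by
  have hM := posDef_controlWeight_of_posDef D hR hK
  have hKt := transpose_eq_of_posDef hK
  have hMt := transpose_eq_of_posDef hM
  refine Matrix.PosDef.of_dotProduct_mulVec_pos ?_ fun {x} hx => ?_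
  · rw [Matrix.IsHermitian, Matrix.conjTranspose_eq_transpose_of_trivial, K_step D hk, P, riccatiP,
      add_comm _ (D.R k)]
    simp only [Matrix.transpose_add, Matrix.transpose_sub, Matrix.transpose_mul,
      Matrix.transpose_transpose, hKt, Matrix.transpose_nonsing_inv,
      transpose_eq_of_posDef hQ]
    have := hMt
    simp only [controlWeight, Matrix.transpose_add, Matrix.transpose_mul, hKt,
      Matrix.transpose_transpose] at this
    rw [this]
    simp only [Matrix.mul_assoc]
  · rw [star_trivial, quadForm_K_step D hk hKt]
    set y := D.A k *ᵥ x
    -- The minimising control, for which the square in `complete_square` vanishes.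
    set u := -((controlWeight D k)⁻¹ *ᵥ ((D.B k)ᵀ *ᵥ (K D (k + 1) *ᵥ y))) with hu
    have key := complete_square (D.B k) hKt hM y 0 u
    rw [add_zero] at key
    have h0 : u + (D.R k + (D.B k)ᵀ * K D (k + 1) * D.B k)⁻¹ *ᵥ
      ((D.B k)ᵀ *ᵥ (K D (k + 1) *ᵥ y)) = 0 := by rw [hu, neg_add_cancel]
    rw [h0] at key
    simp only [zero_dotProduct, mul_zero, add_zero, zero_add] at key
    have h1 := hR.posSemidef.dotProduct_mulVec_nonneg u
    have h2 := hK.posSemidef.dotProduct_mulVec_nonneg (y + D.B k *ᵥ u)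
    have h3 := hQ.dotProduct_mulVec_pos hx
    rw [star_trivial] at h1 h2 h3
    linarith

theorem posDef_K (hQ : ∀ k ≤ D.N, (D.Q k).PosDef) (hR : ∀ k < D.N, (D.R k).PosDef) :
    ∀ k ≤ D.N, (K D k).PosDef := by
  intro k hk
  induction hk using Nat.decreasingInduction with
  | self => rw [K_last]; exact hQ _ le_rfl
  | of_succ k hk ih => exact posDef_K_of_succ D hk (hQ k hk.le) (hR k hk) ih

theorem posDef_controlWeight (hQ : ∀ k ≤ D.N, (D.Q k).PosDef) (hR : ∀ k < D.N, (D.R k).PosDef)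
    {k : ℕ} (hk : k < D.N) : (controlWeight D k).PosDef :=
  posDef_controlWeight_of_posDef D (hR k hk) (posDef_K D hQ hR (k + 1) hk)

/-- The dynamic programming identity at stage `k` along an arbitrary transition. -/
theorem stage_identity {k : ℕ} (hk : k < D.N) (hQ : (D.Q k)ᵀ = D.Q k)
    (hK : (K D (k + 1))ᵀ = K D (k + 1)) (hM : (controlWeight D k).PosDef)
    (x w : Fin n → ℝ) (u : Fin m → ℝ) :
    (x - D.xref k) ⬝ᵥ (D.Q k *ᵥ (x - D.xref k)) + u ⬝ᵥ (D.R k *ᵥ u) +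
        costToGo D (k + 1) (D.A k *ᵥ x + D.B k *ᵥ u + w) =
      costToGo D k x + stageConst D k +
        (u - feedback D k x) ⬝ᵥ (controlWeight D k *ᵥ (u - feedback D k x)) +
        2 * ((K D (k + 1) *ᵥ (D.A k *ᵥ x + D.B k *ᵥ u) + g D (k + 1)) ⬝ᵥ w) +
        w ⬝ᵥ (K D (k + 1) *ᵥ w) := by
  have key := complete_square (D.B k) hK hM (D.A k *ᵥ x) (g D (k + 1)) u
  have hMt := transpose_eq_of_posDef hM
  have hMit : ((controlWeight D k)⁻¹)ᵀ = (controlWeight D k)⁻¹ := by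
    rw [Matrix.transpose_nonsing_inv, hMt]
  rw [costToGo, quadForm_add hK, dotProduct_add (g D (k + 1)), costToGo, quadForm_K_step D hk hK,
    dotProduct_g_step D hk hK, stageConst, feedback, sub_neg_eq_add, add_dotProduct _ _ w]
  rw [Matrix.mulVec_add (D.B k)ᵀ (K D (k + 1) *ᵥ (D.A k *ᵥ x))] at key ⊢
  -- Expanding the subtracted term at `Bᵀ K A x + Bᵀ g` separates the parts quadratic, linear and
  -- constant in `x`.
  rw [quadForm_add hMit, dotProduct_comm (_⁻¹ *ᵥ _)] at key
  have hq : (x - D.xref k) ⬝ᵥ (D.Q k *ᵥ (x - D.xref k)) = x ⬝ᵥ (D.Q k *ᵥ x) -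
      2 * (x ⬝ᵥ (D.Q k *ᵥ D.xref k)) + D.xref k ⬝ᵥ (D.Q k *ᵥ D.xref k) := by
    rw [Matrix.mulVec_sub, sub_dotProduct, dotProduct_sub, dotProduct_sub,
      dotProduct_mulVec_comm_of_symm hQ (D.xref k) x]
    ring
  rw [dotProduct_mulVec_comm_of_symm hMit ((D.B k)ᵀ *ᵥ g D (k + 1))] at key
  rw [hq]
  linarith

theorem terminal_identity (hQ : (D.Q D.N)ᵀ = D.Q D.N) (x : Fin n → ℝ) :
    (x - D.xref D.N) ⬝ᵥ (D.Q D.N *ᵥ (x - D.xref D.N)) =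
      costToGo D D.N x + D.xref D.N ⬝ᵥ (D.Q D.N *ᵥ D.xref D.N) := by
  rw [costToGo, K_last, g_last, Matrix.mulVec_sub, sub_dotProduct, dotProduct_sub, dotProduct_sub,
    dotProduct_mulVec_comm_of_symm hQ (D.xref D.N) x, neg_dotProduct, dotProduct_comm _ x]
  ring

/-! ### Superposition, adaptedness and the information σ-algebra. -/

section ClosedLoop

variable {n m s : ℕ} {Ω : Type*} (D : Data n m s) (x0 : Ω → Fin n → ℝ) (w : ℕ → Ω → Fin n → ℝ)
  (v : ℕ → Ω → Fin s → ℝ) (p : Policy m s)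

/-- The contribution of the controls `u` to the state at stage `k`. -/
def drift (u : ℕ → Fin m → ℝ) : ℕ → Fin n → ℝ
  | 0 => 0
  | k + 1 => D.A k *ᵥ drift u k + D.B k *ᵥ u k

/-- The past controls recorded in an information vector, extended by zero. -/
def pastControls {k : ℕ} (I : Info m s k) (j : ℕ) : Fin m → ℝ :=
  if h : j < k then I.2 ⟨j, h⟩ else 0

/-- The information vector with the effect of the past controls removed. -/
def freeInfo {k : ℕ} (I : Info m s k) : Info m s k :=
  (fun j => I.1 j - D.C j *ᵥ drift D (pastControls I) j, 0)

theorem state_zero (ω : Ω) : state D x0 w v p 0 ω = x0 ω := rfl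

theorem state_succ (k : ℕ) (ω : Ω) : state D x0 w v p (k + 1) ω =
    D.A k *ᵥ state D x0 w v p k ω + D.B k *ᵥ control D x0 w v p k ω + w k ω := rfl

theorem info_fst (k : ℕ) (ω : Ω) (j : Fin (k + 1)) :
    (info D x0 w v p k ω).1 j = D.C j *ᵥ state D x0 w v p j ω + v j ω := by
  induction k with
  | zero =>
    obtain rfl : j = 0 := Fin.ext (by omega)
    rfl
  | succ k ih =>
    refine Fin.lastCases ?_ (fun i => ?_) j
    · simp [info, closedLoop, state]
    · rw [Fin.val_castSucc, ← ih i]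
      simp [info, closedLoop]

theorem info_snd (k : ℕ) (ω : Ω) (j : Fin k) :
    (info D x0 w v p k ω).2 j = control D x0 w v p j ω := by
  induction k with
  | zero => exact j.elim0
  | succ k ih =>
    refine Fin.lastCases ?_ (fun i => ?_) j
    · simp [info, closedLoop, control]
    · rw [Fin.val_castSucc, ← ih i]
      simp [info, closedLoop]

theorem control_zero_policy (k : ℕ) (ω : Ω) : control D x0 w v 0 k ω = 0 := rfl

variable {D} in
theorem drift_congr {u u' : ℕ → Fin m → ℝ} {k : ℕ} (h : ∀ j < k, u j = u' j) :
    drift D u k = drift D u' k := by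
  induction k with
  | zero => rfl
  | succ k ih => rw [drift, drift, ih fun j hj => h j (by omega), h k (by omega)]

/-- Superposition for the linear dynamics. The policy `0` gives the uncontrolled system driven by
the same noise, the reference for all comparisons between policies. -/
theorem state_eq_add_drift (k : ℕ) (ω : Ω) : state D x0 w v p k ω =
    state D x0 w v 0 k ω + drift D (fun j => control D x0 w v p j ω) k := by
  induction k with
  | zero => simp [state_zero, drift]
  | succ k ih =>
    rw [state_succ, state_succ, drift, ih, control_zero_policy, Matrix.mulVec_add,
      Matrix.mulVec_zero]
    abel

theorem drift_pastControls_info {j k : ℕ} (hj : j ≤ k) (ω : Ω) :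
    drift D (pastControls (info D x0 w v p k ω)) j =
      drift D (fun j => control D x0 w v p j ω) j :=
  drift_congr fun i hi => by
    rw [pastControls, dif_pos (by omega : i < k), info_snd]

/-- The past controls are part of `I_k`, so their effect on each observation can be subtracted; the
uncontrolled information is therefore a fixed function of `I_k`. -/
theorem freeInfo_info (k : ℕ) (ω : Ω) :
    freeInfo D (info D x0 w v p k ω) = info D x0 w v 0 k ω := by
  refine Prod.ext (funext fun j => ?_) (funext fun j => ?_)
  · change (info D x0 w v p k ω).1 j - _ = _
    rw [info_fst, info_fst, drift_pastControls_info _ _ _ _ _ (by omega),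
      state_eq_add_drift, Matrix.mulVec_add]
    abel
  · rw [info_snd]; rfl

theorem measurable_mulVec {ι κ α : Type*} [Fintype ι] [Fintype κ] {_ : MeasurableSpace α}
    (M : Matrix κ ι ℝ) {f : α → ι → ℝ} (hf : Measurable f) : Measurable fun a => M *ᵥ f a :=
  (LinearMap.continuous_of_finiteDimensional M.mulVecLin).measurable.comp hf

variable {D} in
theorem measurable_drift {α : Type*} {_ : MeasurableSpace α} {u : α → ℕ → Fin m → ℝ} {k : ℕ}
    (hu : ∀ j < k, Measurable fun a => u a j) : Measurable fun a => drift D (u a) k := by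
  induction k with
  | zero => exact measurable_const
  | succ k ih =>
    exact (measurable_mulVec _ (ih fun j hj => hu j (by omega))).add
      (measurable_mulVec _ (hu k (by omega)))

theorem measurable_pastControls (k j : ℕ) :
    Measurable fun I : Info m s k => pastControls I j := by
  unfold pastControls
  split_ifs with h
  · fun_prop
  · exact measurable_const

theorem measurable_freeInfo (k : ℕ) : Measurable (freeInfo D (k := k)) := by
  refine Measurable.prodMk (measurable_pi_lambda _ fun j => ?_) measurable_const
  exact Measurable.sub (by fun_prop)
    (measurable_mulVec _ (measurable_drift fun i _ => measurable_pastControls k i))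

variable {D x0 w v p}

theorem measurable_info {_ : MeasurableSpace Ω} {k : ℕ}
    (hz : ∀ j ≤ k, Measurable fun ω => D.C j *ᵥ state D x0 w v p j ω + v j ω)
    (hu : ∀ j < k, Measurable (control D x0 w v p j)) : Measurable (info D x0 w v p k) := by
  refine Measurable.prodMk (measurable_pi_lambda _ fun j => ?_) (measurable_pi_lambda _ fun j => ?_)
  · simp only [← info.eq_def, info_fst]
    exact hz j (by omega)
  · simp only [← info.eq_def, info_snd]
    exact hu j j.2

/-- The closed-loop processes are adapted: the state and the information at stage `k` are measurable
for every σ-algebra for which the noise up to that stage is. -/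
theorem measurable_state_and_info {_ : MeasurableSpace Ω} (hx0 : Measurable x0) (k : ℕ)
    (hp : ∀ j < k, Measurable (p j)) (hw : ∀ j < k, Measurable (w j))
    (hv : ∀ j < k, Measurable (v j)) :
    Measurable (state D x0 w v p k) ∧ (Measurable (v k) → Measurable (info D x0 w v p k)) := by
  induction k using Nat.strong_induction_on with
  | _ k ih =>
    have ih' : ∀ j < k, Measurable (state D x0 w v p j) ∧ Measurable (info D x0 w v p j) :=
      fun j hj => by
        have := ih j hj (fun i hi => hp i (by omega)) (fun i hi => hw i (by omega))
          (fun i hi => hv i (by omega))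
        exact ⟨this.1, this.2 (hv j hj)⟩
    have hu : ∀ j < k, Measurable (control D x0 w v p j) := fun j hj =>
      (hp j hj).comp (ih' j hj).2
    have hs : Measurable (state D x0 w v p k) := by
      cases k with
      | zero => exact hx0
      | succ k =>
        exact ((measurable_mulVec _ (ih' k k.lt_succ_self).1).add
          (measurable_mulVec _ (hu k k.lt_succ_self))).add (hw k k.lt_succ_self)
    -- The condition on `v k` is needed for the information only. The state at stage `N` is also
    -- used, and there no `v N` is at hand.
    refine ⟨hs, fun hvk => measurable_info (fun j hj => ?_) hu⟩
    rcases hj.lt_or_eq with hj | rfl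
    · exact (measurable_mulVec _ (ih' j hj).1).add (hv j hj)
    · exact (measurable_mulVec _ hs).add hvk

/-- By strong induction the earlier controls are functions of the uncontrolled observations; adding
their drift to these observations recovers those under `p`. -/
theorem measurable_infoSigma_zero_info {k : ℕ} (hp : ∀ j < k, Measurable (p j)) :
    Measurable[infoSigma D x0 w v 0 k] (info D x0 w v p k) := by
  induction k using Nat.strong_induction_on with
  | _ k ih =>
    have h0 : Measurable[infoSigma D x0 w v 0 k] (info D x0 w v 0 k) := comap_measurable _
    have hz0 : ∀ j ≤ k, Measurable[infoSigma D x0 w v 0 k]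
        fun ω => D.C j *ᵥ state D x0 w v 0 j ω + v j ω := fun j hj => by
      have := (measurable_pi_apply (⟨j, by omega⟩ : Fin (k + 1))).comp (measurable_fst.comp h0)
      simpa only [Function.comp_def, info_fst] using this
    have hmono : ∀ j ≤ k, infoSigma D x0 w v 0 j ≤ infoSigma D x0 w v 0 k := fun j hj => by
      refine Measurable.comap_le ?_
      exact @measurable_info _ _ _ _ _ _ _ _ _ (infoSigma D x0 w v 0 k) _
        (fun i hi => hz0 i (by omega)) fun i _ => measurable_const
    have hu : ∀ j < k, Measurable[infoSigma D x0 w v 0 k] (control D x0 w v p j) := fun j hj =>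
      (hp j hj).comp ((ih j hj fun i hi => hp i (by omega)).mono (hmono j hj.le) le_rfl)
    refine @measurable_info _ _ _ _ _ _ _ _ _ (infoSigma D x0 w v 0 k) _ (fun j hj => ?_) hu
    have hd := @measurable_drift _ _ _ D _ (infoSigma D x0 w v 0 k)
      (fun ω j => control D x0 w v p j ω) j fun i hi => hu i (by omega)
    have := (hz0 j hj).add (measurable_mulVec (D.C j) hd)
    convert this using 1
    funext ω
    rw [Pi.add_apply]
    rw [state_eq_add_drift D x0 w v p, Matrix.mulVec_add]
    abel

/-- There is no dual effect: the information σ-algebra does not depend on the policy. -/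
theorem infoSigma_eq {k : ℕ} (hp : ∀ j < k, Measurable (p j)) :
    infoSigma D x0 w v p k = infoSigma D x0 w v 0 k := by
  refine le_antisymm (measurable_infoSigma_zero_info hp).comap_le (Measurable.comap_le ?_)
  have : info D x0 w v 0 k = freeInfo D ∘ info D x0 w v p k :=
    funext fun ω => (freeInfo_info D x0 w v p k ω).symm
  rw [this]
  exact (measurable_freeInfo D k).comp (comap_measurable _)

theorem measurable_control_infoSigma {k : ℕ} (hp : Measurable (p k)) :
    Measurable[infoSigma D x0 w v p k] (control D x0 w v p k) :=
  hp.comp (comap_measurable _)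

theorem measurable_drift_infoSigma (k : ℕ) :
    Measurable[infoSigma D x0 w v p k]
      fun ω => drift D (fun j => control D x0 w v p j ω) k := by
  have : (fun ω => drift D (fun j => control D x0 w v p j ω) k) =
      (fun I : Info m s k => drift D (pastControls I) k) ∘ info D x0 w v p k :=
    funext fun ω => (drift_pastControls_info D x0 w v p le_rfl ω).symm
  rw [this]
  exact (measurable_drift fun j _ => measurable_pastControls k j).comp (comap_measurable _)

/-- The dynamic programming identity summed along a trajectory. -/
theorem pathCost_eq (hQ : ∀ k ≤ D.N, (D.Q k).PosDef) (hR : ∀ k < D.N, (D.R k).PosDef) (ω : Ω) :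
    pathCost D x0 w v p ω = costToGo D 0 (x0 ω) + D.xref D.N ⬝ᵥ (D.Q D.N *ᵥ D.xref D.N) +
      ∑ k ∈ Finset.range D.N, (stageConst D k +
        (control D x0 w v p k ω - feedback D k (state D x0 w v p k ω)) ⬝ᵥ (controlWeight D k *ᵥ
          (control D x0 w v p k ω - feedback D k (state D x0 w v p k ω))) +
        2 * ((K D (k + 1) *ᵥ (D.A k *ᵥ state D x0 w v p k ω + D.B k *ᵥ control D x0 w v p k ω)
          + g D (k + 1)) ⬝ᵥ w k ω) +
        w k ω ⬝ᵥ (K D (k + 1) *ᵥ w k ω)) := by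
  -- The increments of `costToGo` along the trajectory telescope, which reduces the claim to
  -- `stage_identity` at each stage.
  have hsum := Finset.sum_range_sub (fun k => costToGo D k (state D x0 w v p k ω)) D.N
  rw [pathCost, terminal_identity D (transpose_eq_of_posDef (hQ _ le_rfl)),
    ← sub_eq_zero]
  rw [state_zero] at hsum
  have : ∀ a b c d e f : ℝ, d - e = f → a = b - f → d + c + a - (e + c + b) = 0 := by
    intros; linarith
  refine this _ _ _ _ _ _ hsum.symm ?_
  rw [← Finset.sum_sub_distrib]
  refine Finset.sum_congr rfl fun k hk => ?_
  have hk := Finset.mem_range.1 hk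
  have := stage_identity D hk (transpose_eq_of_posDef (hQ k hk.le))
    (transpose_eq_of_posDef (posDef_K D hQ hR (k + 1) hk)) (posDef_controlWeight D hQ hR hk)
    (state D x0 w v p k ω) (w k ω) (control D x0 w v p k ω)
  rw [state_succ]
  linarith

end ClosedLoop

/-! ### Square-integrable random vectors, orthogonality and independence. -/

section Auxiliary

variable {Ω ι κ : Type*} [Fintype ι] [Fintype κ] {mΩ : MeasurableSpace Ω} {μ : Measure Ω}

theorem memLp_mulVec (M : Matrix κ ι ℝ) {f : Ω → ι → ℝ} (hf : MemLp f 2 μ) :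
    MemLp (fun ω => M *ᵥ f ω) 2 μ :=
  (LinearMap.toContinuousLinearMap M.mulVecLin).comp_memLp' hf

theorem integrable_dotProduct {f g : Ω → ι → ℝ} (hf : MemLp f 2 μ) (hg : MemLp g 2 μ) :
    Integrable (fun ω => f ω ⬝ᵥ g ω) μ :=
  integrable_finsetSum _ fun i _ => (hf.eval i).integrable_mul (hg.eval i)

theorem integrable_quadForm (M : Matrix ι ι ℝ) {f : Ω → ι → ℝ} (hf : MemLp f 2 μ) :
    Integrable (fun ω => f ω ⬝ᵥ (M *ᵥ f ω)) μ :=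
  integrable_dotProduct hf (memLp_mulVec M hf)

theorem integral_eval_eq {g : Ω → ι → ℝ} (hg : Integrable g μ) (i : ι) :
    (∫ ω, g ω ∂μ) i = ∫ ω, g ω i ∂μ :=
  ((ContinuousLinearMap.proj (R := ℝ) (φ := fun _ : ι => ℝ) i).integral_comp_comm hg).symm

theorem integral_dotProduct_of_indepFun [IsProbabilityMeasure μ] {f g : Ω → ι → ℝ}
    (hf : MemLp f 2 μ) (hg : MemLp g 2 μ) (hg0 : ∫ ω, g ω ∂μ = 0) (hfg : IndepFun f g μ) :
    ∫ ω, f ω ⬝ᵥ g ω ∂μ = 0 := by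
  refine (integral_finsetSum _ fun i _ => (hf.eval i).integrable_mul (hg.eval i)).trans
    (Finset.sum_eq_zero fun i _ => ?_)
  have hi : IndepFun (fun ω => f ω i) (fun ω => g ω i) μ :=
    hfg.comp (measurable_pi_apply i) (measurable_pi_apply i)
  have := hi.integral_mul_eq_mul_integral (hf.eval i).aestronglyMeasurable
    (hg.eval i).aestronglyMeasurable
  rw [← integral_eval_eq (hg.integrable one_le_two) i, hg0, Pi.zero_apply, mul_zero] at this
  exact this

/-- The estimation error is orthogonal to every square-integrable function of the observations. -/
theorem integral_dotProduct_sub_condExp [IsProbabilityMeasure μ] {m : MeasurableSpace Ω}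
    (hm : m ≤ mΩ) {d f : Ω → ι → ℝ} (hdm : Measurable[m] d) (hd : MemLp d 2 μ)
    (hf : MemLp f 2 μ) : ∫ ω, d ω ⬝ᵥ (f ω - (μ[f | m]) ω) ∂μ = 0 := by
  have hf' : MemLp (μ[f | m]) 2 μ := hf.condExp one_le_two
  refine (integral_finsetSum _ fun i _ => (hd.eval i).integrable_mul ((hf.sub hf').eval i)).trans
    (Finset.sum_eq_zero fun i _ => ?_)
  change ∫ ω, d ω i * (f ω - (μ[f | m]) ω) i ∂μ = 0
  have hdi : StronglyMeasurable[m] (fun ω => d ω i) :=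
    ((measurable_pi_apply i).comp hdm).stronglyMeasurable
  have hi : (fun ω => (μ[f | m]) ω i) =ᵐ[μ] μ[fun ω => f ω i | m] :=
    (ContinuousLinearMap.proj (R := ℝ) (φ := fun _ : ι => ℝ) i).comp_condExp_comm
      (hf.integrable one_le_two)
  have hdf : Integrable ((fun ω => d ω i) * fun ω => f ω i) μ :=
    (hd.eval i).integrable_mul (hf.eval i)
  have hdf' : Integrable ((fun ω => d ω i) * fun ω => (μ[f | m]) ω i) μ :=
    (hd.eval i).integrable_mul (hf'.eval i)
  have hpull := condExp_mul_of_stronglyMeasurable_left hdi hdf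
    ((hf.eval i).integrable one_le_two)
  have h1 : ∫ ω, ((fun ω => d ω i) * fun ω => f ω i) ω ∂μ =
      ∫ ω, ((fun ω => d ω i) * fun ω => (μ[f | m]) ω i) ω ∂μ := by
    rw [← integral_condExp hm]
    refine integral_congr_ae ?_
    filter_upwards [hpull, hi] with ω h1 h2
    rw [h1, Pi.mul_apply, Pi.mul_apply, h2]
  have h2 : (fun ω => d ω i * (f ω - (μ[f | m]) ω) i) = fun ω =>
      ((fun ω => d ω i) * fun ω => f ω i) ω - ((fun ω => d ω i) * fun ω => (μ[f | m]) ω i) ω := by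
    funext ω
    simp only [Pi.mul_apply, Pi.sub_apply]
    ring
  rw [h2, integral_sub hdf hdf', h1, sub_self]

open scoped MatrixOrder Matrix.Norms.L2Operator in
/-- A random vector whose positive definite quadratic form is integrable is square-integrable. -/
theorem memLp_two_of_integrable_quadForm [DecidableEq ι] {S : Matrix ι ι ℝ} (hS : S.PosDef)
    {f : Ω → ι → ℝ} (hf : Measurable f) (hint : Integrable (fun ω => f ω ⬝ᵥ (S *ᵥ f ω)) μ) :
    MemLp f 2 μ := by
  -- With this factorisation the quadratic form is the sum of the squared coordinates of `T *ᵥ f`,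
  -- so each coordinate is square-integrable; `T` is invertible, and `f` is recovered from `T *ᵥ f`.
  obtain ⟨T, hT⟩ : ∃ T : Matrix ι ι ℝ, S = Tᵀ * T :=
    CStarAlgebra.nonneg_iff_eq_star_mul_self.mp hS.posSemidef.nonneg
  have hdet : IsUnit T.det := by
    have := (Matrix.isUnit_iff_isUnit_det _).1 hS.isUnit
    rw [hT, Matrix.det_mul] at this
    exact isUnit_of_mul_isUnit_right this
  have hTf : MemLp (fun ω => T *ᵥ f ω) 2 μ := by
    refine memLp_pi_iff.2 fun i => ?_
    have hmeas : Measurable fun ω => (T *ᵥ f ω) i :=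
      (measurable_pi_apply i).comp (measurable_mulVec T hf)
    refine (memLp_two_iff_integrable_sq hmeas.aestronglyMeasurable).2 ?_
    refine hint.mono' (hmeas.pow_const 2).aestronglyMeasurable (ae_of_all _ fun ω => ?_)
    rw [hT, ← Matrix.mulVec_mulVec, dotProduct_transpose_mulVec, Real.norm_of_nonneg (sq_nonneg _),
      sq]
    exact Finset.single_le_sum (f := fun i => (T *ᵥ f ω) i * (T *ᵥ f ω) i)
      (fun j _ => mul_self_nonneg _) (Finset.mem_univ i)
  have := memLp_mulVec T⁻¹ hTf
  simpa only [Matrix.mulVec_mulVec, Matrix.nonsing_inv_mul _ hdet, Matrix.one_mulVec] using this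

/-- The hypotheses make `X`, `Y`, `Z` jointly independent, so the law factorises on boxes, which
determine it. It serves to move one more independent block to the side opposite `w_k`. -/
theorem indepFun_prodMk_of_indepFun [IsProbabilityMeasure μ] {α β γ : Type*} [MeasurableSpace α]
    [MeasurableSpace β] [MeasurableSpace γ] {X : Ω → α} {Y : Ω → β} {Z : Ω → γ}
    (hX : Measurable X) (hY : Measurable Y) (hZ : Measurable Z)
    (h : IndepFun X (fun ω => (Y ω, Z ω)) μ) (hYZ : IndepFun Y Z μ) :
    IndepFun Y (fun ω => (X ω, Z ω)) μ := by
  have := Measure.isProbabilityMeasure_map (μ := μ) hX.aemeasurable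
  have := Measure.isProbabilityMeasure_map (μ := μ) hY.aemeasurable
  have := Measure.isProbabilityMeasure_map (μ := μ) hZ.aemeasurable
  have hXZ : IndepFun X Z μ := h.comp measurable_id measurable_snd
  rw [indepFun_iff_map_prod_eq_prod_map_map hY.aemeasurable (hX.prodMk hZ).aemeasurable,
    hXZ.map_prod_eq_prod_map_map hX.aemeasurable hZ.aemeasurable]
  refine Measure.ext_prod₃ fun {s t u} hs ht hu => ?_
  rw [Measure.map_apply (hY.prodMk (hX.prodMk hZ)) (hs.prod (ht.prod hu)), Measure.prod_prod,
    Measure.prod_prod, Measure.map_apply hX ht, Measure.map_apply hY hs, Measure.map_apply hZ hu]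
  have h1 := h.measure_inter_preimage_eq_mul t (s ×ˢ u) ht (hs.prod hu)
  have h2 := hYZ.measure_inter_preimage_eq_mul s u hs hu
  have h3 : (fun ω => (Y ω, X ω, Z ω)) ⁻¹' s ×ˢ t ×ˢ u =
      X ⁻¹' t ∩ (fun ω => (Y ω, Z ω)) ⁻¹' s ×ˢ u := by
    ext ω; simp only [Set.mem_preimage, Set.mem_prod, Set.mem_inter_iff]; tauto
  have h4 : (fun ω => (Y ω, Z ω)) ⁻¹' s ×ˢ u = Y ⁻¹' s ∩ Z ⁻¹' u := rfl
  rw [h3, h1, h4, h2]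
  ring

end Auxiliary

/-! ### Noise assumptions and independence of the current disturbance. -/

variable {n m s : ℕ} {Ω : Type*} {mΩ : MeasurableSpace Ω}

/-- The assumptions on the initial state and the noise. -/
structure IsNoise (D : Data n m s) (x0 : Ω → Fin n → ℝ) (w : ℕ → Ω → Fin n → ℝ)
    (v : ℕ → Ω → Fin s → ℝ) (μ : Measure Ω) : Prop where
  measurable_x0 : Measurable x0
  measurable_w : ∀ k < D.N, Measurable (w k)
  measurable_v : ∀ k < D.N, Measurable (v k)
  memLp_x0 : MemLp x0 2 μ
  memLp_w : ∀ k < D.N, MemLp (w k) 2 μ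
  integral_w : ∀ k < D.N, ∫ ω, w k ω ∂μ = 0
  iIndepFun_w : iIndepFun (fun k : Fin D.N => w k) μ
  indepFun_x0_w : IndepFun x0 (fun ω (k : Fin D.N) => w k ω) μ
  indepFun_v : IndepFun (fun ω (k : Fin D.N) => v k ω)
    (fun ω => (x0 ω, fun k : Fin D.N => w k ω)) μ

variable {D : Data n m s} {x0 : Ω → Fin n → ℝ} {w : ℕ → Ω → Fin n → ℝ} {v : ℕ → Ω → Fin s → ℝ}
  {μ : Measure Ω} {p : Policy m s}

theorem IsNoise.measurable_state (h : IsNoise D x0 w v μ) (hp : Admissible D.N p) {k : ℕ}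
    (hk : k ≤ D.N) : Measurable (state D x0 w v p k) :=
  (measurable_state_and_info h.measurable_x0 k (fun j hj => hp j (by omega))
    (fun j hj => h.measurable_w j (by omega)) fun j hj => h.measurable_v j (by omega)).1

theorem IsNoise.measurable_info (h : IsNoise D x0 w v μ) (hp : Admissible D.N p) {k : ℕ}
    (hk : k < D.N) : Measurable (info D x0 w v p k) :=
  (measurable_state_and_info h.measurable_x0 k (fun j hj => hp j (by omega))
    (fun j hj => h.measurable_w j (by omega)) fun j hj => h.measurable_v j (by omega)).2
    (h.measurable_v k hk)

theorem IsNoise.measurable_control (h : IsNoise D x0 w v μ) (hp : Admissible D.N p) {k : ℕ}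
    (hk : k < D.N) : Measurable (control D x0 w v p k) :=
  (hp k hk).comp (h.measurable_info hp hk)

theorem IsNoise.memLp_state (h : IsNoise D x0 w v μ) {k : ℕ} (hk : k ≤ D.N)
    (hu : ∀ j < k, MemLp (control D x0 w v p j) 2 μ) : MemLp (state D x0 w v p k) 2 μ := by
  induction k with
  | zero => exact h.memLp_x0
  | succ k ih =>
    have hx := memLp_mulVec (D.A k) (ih (by omega) fun j hj => hu j (by omega))
    have hu' := memLp_mulVec (D.B k) (hu k k.lt_succ_self)
    exact (hx.add hu').add (h.memLp_w k hk)

theorem memLp_fun_add {E : Type*} [NormedAddCommGroup E] {f g : Ω → E} (hf : MemLp f 2 μ)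
    (hg : MemLp g 2 μ) : MemLp (fun ω => f ω + g ω) 2 μ := hf.add hg

variable [IsProbabilityMeasure μ]

/-- The process noise at stage `k` is independent of the state and the control at that stage. -/
theorem IsNoise.indepFun_w (h : IsNoise D x0 w v μ) (hp : Admissible D.N p) {k : ℕ}
    (hk : k < D.N) :
    IndepFun (fun ω => (state D x0 w v p k ω, control D x0 w v p k ω)) (w k) μ := by
  classical
  let S : Finset (Fin D.N) := {⟨k, hk⟩}
  let T : Finset (Fin D.N) := Finset.univ.filter fun j => (j : ℕ) < k
  have hST : Disjoint S T := by simp [S, T]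
  let Y : Ω → S → Fin n → ℝ := fun ω i => w i ω
  let Z : Ω → T → Fin n → ℝ := fun ω i => w i ω
  let V : Ω → Fin D.N → Fin s → ℝ := fun ω i => v i ω
  have hY : Measurable Y := measurable_pi_lambda _ fun i => h.measurable_w _ i.1.2
  have hZ : Measurable Z := measurable_pi_lambda _ fun i => h.measurable_w _ i.1.2
  have hV : Measurable V := measurable_pi_lambda _ fun i => h.measurable_v _ i.2
  have hYZ : IndepFun Y Z μ :=
    h.iIndepFun_w.indepFun_finset S T hST fun i => h.measurable_w _ i.2
  have hXYZ : IndepFun x0 (fun ω => (Y ω, Z ω)) μ :=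
    h.indepFun_x0_w.comp (φ := id)
      (ψ := fun W : Fin D.N → Fin n → ℝ => ((fun i : S => W i), (fun i : T => W i)))
      measurable_id (by fun_prop)
  -- The regrouping lemma is applied twice: first it adjoins `x0` to the past disturbances, then the
  -- whole observation noise.
  have hY_XZ := indepFun_prodMk_of_indepFun h.measurable_x0 hY hZ hXYZ hYZ
  have hV_YXZ : IndepFun V (fun ω => (Y ω, x0 ω, Z ω)) μ :=
    h.indepFun_v.comp (φ := id)
      (ψ := fun W : (Fin n → ℝ) × (Fin D.N → Fin n → ℝ) =>
        ((fun i : S => W.2 i), W.1, (fun i : T => W.2 i))) measurable_id (by fun_prop)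
  have hY_all := indepFun_prodMk_of_indepFun hV hY (h.measurable_x0.prodMk hZ) hV_YXZ hY_XZ
  have hwk : IndepFun (w k) (fun ω => (V ω, x0 ω, Z ω)) μ :=
    hY_all.comp (φ := fun W : S → Fin n → ℝ => W ⟨⟨k, hk⟩, by simp [S]⟩) (ψ := id) (by fun_prop)
      measurable_id
  refine IndepFun.symm ?_
  rw [IndepFun_iff_Indep] at hwk ⊢
  refine indep_of_indep_of_le_right hwk (Measurable.comap_le ?_)
  -- This σ-algebra is generated by `x0`, all the observation noise and the disturbances before
  -- stage `k`; the state and control at stage `k` are measurable for it by adaptedness.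
  set G : MeasurableSpace Ω := MeasurableSpace.comap (fun ω => (V ω, x0 ω, Z ω)) inferInstance
  have hG : Measurable[G] fun ω => (V ω, x0 ω, Z ω) := comap_measurable _
  have hx : Measurable[G] x0 := measurable_fst.comp (measurable_snd.comp hG)
  have hv' : ∀ j < D.N, Measurable[G] (v j) := fun j hj =>
    (measurable_pi_apply (⟨j, hj⟩ : Fin D.N)).comp (measurable_fst.comp hG)
  have hw' : ∀ j < k, Measurable[G] (w j) := fun j hj =>
    (measurable_pi_apply (⟨⟨j, hj.trans hk⟩, by simp [T, hj]⟩ : T)).comp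
      (measurable_snd.comp (measurable_snd.comp hG))
  have := @measurable_state_and_info n m s Ω D x0 w v p G hx k (fun j hj => hp j (by omega)) hw'
    fun j hj => hv' j (by omega)
  exact this.1.prodMk ((hp k hk).comp (this.2 (hv' k hk)))

theorem memLp_zero_control (k : ℕ) : MemLp (control D x0 w v 0 k) 2 μ :=
  memLp_const (0 : Fin m → ℝ)

theorem memLp_drift {k : ℕ} (hu : ∀ j < k, MemLp (control D x0 w v p j) 2 μ) :
    MemLp (fun ω => drift D (fun j => control D x0 w v p j ω) k) 2 μ := by
  induction k with
  | zero => exact memLp_const (0 : Fin n → ℝ)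
  | succ k ih =>
    have hx := memLp_mulVec (D.A k) (ih fun j hj => hu j (by omega))
    exact hx.add (memLp_mulVec (D.B k) (hu k k.lt_succ_self))

theorem memLp_feedback (k : ℕ) {f : Ω → Fin n → ℝ} (hf : MemLp f 2 μ) :
    MemLp (fun ω => feedback D k (f ω)) 2 μ := by
  have h1 := memLp_mulVec (K D (k + 1)) (memLp_mulVec (D.A k) hf)
  have h2 : MemLp (fun ω => K D (k + 1) *ᵥ (D.A k *ᵥ f ω) + g D (k + 1)) 2 μ :=
    h1.add (memLp_const _)
  exact (memLp_mulVec (controlWeight D k)⁻¹ (memLp_mulVec (D.B k)ᵀ h2)).neg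

theorem measurable_feedback (k : ℕ) {f : Ω → Fin n → ℝ} (hf : Measurable f) :
    Measurable fun ω => feedback D k (f ω) := by
  have h1 := measurable_mulVec (K D (k + 1)) (measurable_mulVec (D.A k) hf)
  exact (measurable_mulVec (controlWeight D k)⁻¹
    (measurable_mulVec (D.B k)ᵀ (h1.add_const (g D (k + 1))))).neg

/-! ### Estimation error and decomposition of the expected cost. -/

variable (D x0 w v μ) in
/-- The error of the state estimate for the uncontrolled system. -/
noncomputable def estimationError (k : ℕ) (ω : Ω) : Fin n → ℝ :=
  state D x0 w v 0 k ω - (μ[state D x0 w v 0 k | infoSigma D x0 w v 0 k]) ω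

/-- The state estimate is that of the uncontrolled system, shifted by the effect of the controls. -/
theorem IsNoise.condExp_state (h : IsNoise D x0 w v μ) (hp : Admissible D.N p) {k : ℕ}
    (hk : k < D.N) (hu : ∀ j < k, MemLp (control D x0 w v p j) 2 μ) :
    μ[state D x0 w v p k | infoSigma D x0 w v p k] =ᵐ[μ] fun ω =>
      (μ[state D x0 w v 0 k | infoSigma D x0 w v 0 k]) ω +
        drift D (fun j => control D x0 w v p j ω) k := by
  have hσ : infoSigma D x0 w v p k = infoSigma D x0 w v 0 k :=
    infoSigma_eq fun j hj => hp j (by omega)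
  have hle : infoSigma D x0 w v p k ≤ mΩ := (h.measurable_info hp hk).comap_le
  have hs : state D x0 w v p k = state D x0 w v 0 k +
      fun ω => drift D (fun j => control D x0 w v p j ω) k :=
    funext fun ω => state_eq_add_drift D x0 w v p k ω
  have hd := (memLp_drift hu).integrable one_le_two
  have h0 := (h.memLp_state hk.le fun j _ => memLp_zero_control j).integrable one_le_two
  rw [← hσ, hs]
  filter_upwards [condExp_add h0 hd (infoSigma D x0 w v p k)] with ω hω
  rw [hω, Pi.add_apply, condExp_of_stronglyMeasurable hle
    (measurable_drift_infoSigma k).stronglyMeasurable hd]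

/-- The drift enters the state and its estimate alike and cancels, leaving an error free of the
policy. -/
theorem IsNoise.state_sub_condExp (h : IsNoise D x0 w v μ) (hp : Admissible D.N p) {k : ℕ}
    (hk : k < D.N) (hu : ∀ j < k, MemLp (control D x0 w v p j) 2 μ) :
    ∀ᵐ ω ∂μ, state D x0 w v p k ω -
      (μ[state D x0 w v p k | infoSigma D x0 w v p k]) ω = estimationError D x0 w v μ k ω := by
  filter_upwards [h.condExp_state hp hk hu] with ω hω
  rw [hω, state_eq_add_drift, estimationError]
  abel

/-- The matrix of the linear part of the feedback at stage `k`. -/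
noncomputable def gain (D : Data n m s) (k : ℕ) : Matrix (Fin m) (Fin n) ℝ :=
  (controlWeight D k)⁻¹ * (D.B k)ᵀ * K D (k + 1) * D.A k

theorem feedback_sub_feedback (k : ℕ) (x y : Fin n → ℝ) :
    feedback D k x - feedback D k y = -(gain D k *ᵥ (x - y)) := by
  simp only [feedback, gain, ← Matrix.mulVec_mulVec, Matrix.mulVec_sub, Matrix.mulVec_add]
  abel

variable (D x0 w v μ p) in
/-- The deviation of the control at stage `k` from the certainty-equivalent feedback. -/
noncomputable def deviation (k : ℕ) (ω : Ω) : Fin m → ℝ :=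
  control D x0 w v p k ω -
    feedback D k ((μ[state D x0 w v p k | infoSigma D x0 w v p k]) ω)

variable (D x0 w v μ) in
/-- The part of the expected cost that does not depend on the policy. -/
noncomputable def baseCost : ℝ :=
  ∫ ω, (costToGo D 0 (x0 ω) + D.xref D.N ⬝ᵥ (D.Q D.N *ᵥ D.xref D.N)) ∂μ +
    ∑ k ∈ Finset.range D.N, (stageConst D k +
      (∫ ω, (gain D k *ᵥ estimationError D x0 w v μ k ω) ⬝ᵥ
        (controlWeight D k *ᵥ (gain D k *ᵥ estimationError D x0 w v μ k ω)) ∂μ) +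
      ∫ ω, w k ω ⬝ᵥ (K D (k + 1) *ᵥ w k ω) ∂μ)

variable (D x0 w v μ p) in
/-- The expected cost incurred by deviating from the certainty-equivalent feedback at stage `k`. -/
noncomputable def stageExcess (k : ℕ) : ℝ :=
  ∫ ω, deviation D x0 w v μ p k ω ⬝ᵥ (controlWeight D k *ᵥ deviation D x0 w v μ p k ω) ∂μ

theorem IsNoise.memLp_deviation (h : IsNoise D x0 w v μ)
    (hu : ∀ k < D.N, MemLp (control D x0 w v p k) 2 μ) {k : ℕ} (hk : k < D.N) :
    MemLp (deviation D x0 w v μ p k) 2 μ :=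
  (hu k hk).sub (memLp_feedback k
    ((h.memLp_state hk.le fun j hj => hu j (by omega)).condExp one_le_two))

theorem IsNoise.memLp_estimationError (h : IsNoise D x0 w v μ) {k : ℕ} (hk : k < D.N) :
    MemLp (estimationError D x0 w v μ k) 2 μ :=
  have h0 := h.memLp_state (p := 0) hk.le fun j _ => memLp_zero_control j
  h0.sub (h0.condExp one_le_two)

/-- The separation of the control cost into the deviation from the certainty-equivalent feedback and
the estimation error. -/
theorem IsNoise.integral_control_sub_feedback (h : IsNoise D x0 w v μ) (hp : Admissible D.N p)
    (hu : ∀ k < D.N, MemLp (control D x0 w v p k) 2 μ) {k : ℕ} (hk : k < D.N)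
    (hM : (controlWeight D k)ᵀ = controlWeight D k) :
    ∫ ω, (control D x0 w v p k ω - feedback D k (state D x0 w v p k ω)) ⬝ᵥ (controlWeight D k *ᵥ
        (control D x0 w v p k ω - feedback D k (state D x0 w v p k ω))) ∂μ =
      stageExcess D x0 w v μ p k +
        ∫ ω, (gain D k *ᵥ estimationError D x0 w v μ k ω) ⬝ᵥ
          (controlWeight D k *ᵥ (gain D k *ᵥ estimationError D x0 w v μ k ω)) ∂μ := by
  have hx := h.memLp_state hk.le fun j hj => hu j (hj.trans hk)
  have hd := h.memLp_deviation hu hk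
  have he := memLp_mulVec (gain D k) (h.memLp_estimationError hk)
  have hle : infoSigma D x0 w v p k ≤ mΩ := (h.measurable_info hp hk).comap_le
  have hdm : Measurable[infoSigma D x0 w v p k] (deviation D x0 w v μ p k) :=
    (measurable_control_infoSigma (hp k hk)).sub
      (@measurable_feedback n m s Ω (infoSigma D x0 w v p k) D k _
        stronglyMeasurable_condExp.measurable)
  have herr := h.state_sub_condExp hp hk fun j hj => hu j (hj.trans hk)
  have hcross : ∫ ω, (controlWeight D k *ᵥ deviation D x0 w v μ p k ω) ⬝ᵥ
      (gain D k *ᵥ estimationError D x0 w v μ k ω) ∂μ = 0 := by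
    -- The gain is moved by transposition onto the deviation, which stays measurable for the
    -- information and leaves the bare error `x_k - E[x_k | I_k]` as second factor.
    have := integral_dotProduct_sub_condExp hle
      (measurable_mulVec (gain D k)ᵀ (measurable_mulVec (controlWeight D k) hdm))
      (memLp_mulVec (gain D k)ᵀ (memLp_mulVec (controlWeight D k) hd)) hx
    rw [← this]
    refine integral_congr_ae ?_
    filter_upwards [herr] with ω hω
    rw [hω, dotProduct_comm _ (estimationError D x0 w v μ k ω), dotProduct_transpose_mulVec,
      dotProduct_comm]
  have hsplit : ∀ᵐ ω ∂μ, control D x0 w v p k ω - feedback D k (state D x0 w v p k ω) =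
      deviation D x0 w v μ p k ω + gain D k *ᵥ estimationError D x0 w v μ k ω := by
    filter_upwards [herr] with ω hω
    rw [← hω, deviation, ← neg_eq_iff_eq_neg.2 (feedback_sub_feedback k _ _)]
    abel
  have hcongr : ∫ ω, (control D x0 w v p k ω - feedback D k (state D x0 w v p k ω)) ⬝ᵥ
        (controlWeight D k *ᵥ
          (control D x0 w v p k ω - feedback D k (state D x0 w v p k ω))) ∂μ =
      ∫ ω, (deviation D x0 w v μ p k ω ⬝ᵥ (controlWeight D k *ᵥ deviation D x0 w v μ p k ω) +
        2 * ((controlWeight D k *ᵥ deviation D x0 w v μ p k ω) ⬝ᵥ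
          (gain D k *ᵥ estimationError D x0 w v μ k ω)) +
        (gain D k *ᵥ estimationError D x0 w v μ k ω) ⬝ᵥ
          (controlWeight D k *ᵥ (gain D k *ᵥ estimationError D x0 w v μ k ω))) ∂μ := by
    refine integral_congr_ae ?_
    filter_upwards [hsplit] with ω hω
    rw [hω, quadForm_add hM]
  have hi1 := integrable_quadForm (controlWeight D k) hd
  have hi2 := (integrable_dotProduct (memLp_mulVec (controlWeight D k) hd) he).const_mul 2
  have hi3 := integrable_quadForm (controlWeight D k) he
  rw [hcongr, integral_add (hi1.fun_add hi2) hi3, integral_add hi1 hi2, integral_const_mul, hcross,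
    mul_zero, add_zero, stageExcess]

theorem integral_const_add_add_add {f₁ f₂ f₃ : Ω → ℝ} (c : ℝ) (h₁ : Integrable f₁ μ)
    (h₂ : Integrable f₂ μ) (h₃ : Integrable f₃ μ) (h0 : ∫ ω, f₂ ω ∂μ = 0) :
    Integrable (fun ω => c + f₁ ω + 2 * f₂ ω + f₃ ω) μ ∧
      ∫ ω, (c + f₁ ω + 2 * f₂ ω + f₃ ω) ∂μ = c + ∫ ω, f₁ ω ∂μ + ∫ ω, f₃ ω ∂μ := by
  have hc : Integrable (fun _ : Ω => c) μ := integrable_const _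
  refine ⟨((hc.fun_add h₁).fun_add (h₂.const_mul 2)).fun_add h₃, ?_⟩
  rw [integral_add ((hc.fun_add h₁).fun_add (h₂.const_mul 2)) h₃,
    integral_add (hc.fun_add h₁) (h₂.const_mul 2), integral_add hc h₁, integral_const_mul, h0]
  simp

/-- The expectation of the terms that stage `k` contributes to the cost. -/
theorem IsNoise.integral_stage (h : IsNoise D x0 w v μ) (hp : Admissible D.N p)
    (hu : ∀ k < D.N, MemLp (control D x0 w v p k) 2 μ) {k : ℕ} (hk : k < D.N)
    (hM : (controlWeight D k)ᵀ = controlWeight D k) :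
    Integrable (fun ω => stageConst D k +
        (control D x0 w v p k ω - feedback D k (state D x0 w v p k ω)) ⬝ᵥ (controlWeight D k *ᵥ
          (control D x0 w v p k ω - feedback D k (state D x0 w v p k ω))) +
        2 * ((K D (k + 1) *ᵥ (D.A k *ᵥ state D x0 w v p k ω + D.B k *ᵥ control D x0 w v p k ω)
          + g D (k + 1)) ⬝ᵥ w k ω) +
        w k ω ⬝ᵥ (K D (k + 1) *ᵥ w k ω)) μ ∧
    ∫ ω, (stageConst D k +
        (control D x0 w v p k ω - feedback D k (state D x0 w v p k ω)) ⬝ᵥ (controlWeight D k *ᵥ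
          (control D x0 w v p k ω - feedback D k (state D x0 w v p k ω))) +
        2 * ((K D (k + 1) *ᵥ (D.A k *ᵥ state D x0 w v p k ω + D.B k *ᵥ control D x0 w v p k ω)
          + g D (k + 1)) ⬝ᵥ w k ω) +
        w k ω ⬝ᵥ (K D (k + 1) *ᵥ w k ω)) ∂μ =
      stageConst D k + (stageExcess D x0 w v μ p k +
        ∫ ω, (gain D k *ᵥ estimationError D x0 w v μ k ω) ⬝ᵥ
          (controlWeight D k *ᵥ (gain D k *ᵥ estimationError D x0 w v μ k ω)) ∂μ) +
      ∫ ω, w k ω ⬝ᵥ (K D (k + 1) *ᵥ w k ω) ∂μ := by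
  have hx := h.memLp_state hk.le fun j hj => hu j (hj.trans hk)
  have hd : MemLp (fun ω => control D x0 w v p k ω - feedback D k (state D x0 w v p k ω)) 2 μ :=
    (hu k hk).sub (memLp_feedback k hx)
  have hy := memLp_fun_add (memLp_mulVec (K D (k + 1)) (memLp_fun_add
    (memLp_mulVec (D.A k) hx) (memLp_mulVec (D.B k) (hu k hk)))) (memLp_const (g D (k + 1)))
  have hmeas : Measurable fun q : (Fin n → ℝ) × (Fin m → ℝ) =>
      K D (k + 1) *ᵥ (D.A k *ᵥ q.1 + D.B k *ᵥ q.2) + g D (k + 1) :=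
    (measurable_mulVec (K D (k + 1)) ((measurable_mulVec (D.A k) measurable_fst).fun_add
      (measurable_mulVec (D.B k) measurable_snd))).add_const _
  have hind := (h.indepFun_w hp hk).comp hmeas measurable_id
  have hcross := integral_dotProduct_of_indepFun hy (h.memLp_w k hk) (h.integral_w k hk) hind
  rw [← h.integral_control_sub_feedback hp hu hk hM]
  exact integral_const_add_add_add _ (integrable_quadForm _ hd)
    (integrable_dotProduct hy (h.memLp_w k hk)) (integrable_quadForm _ (h.memLp_w k hk)) hcross

/-- For a policy with square-integrable controls, the expected cost is the policy-independent base
cost plus the excess costs of the stages. -/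
theorem IsNoise.integral_pathCost (h : IsNoise D x0 w v μ)
    (hQ : ∀ k ≤ D.N, (D.Q k).PosDef) (hR : ∀ k < D.N, (D.R k).PosDef) (hp : Admissible D.N p)
    (hu : ∀ k < D.N, MemLp (control D x0 w v p k) 2 μ) :
    Integrable (pathCost D x0 w v p) μ ∧ ∫ ω, pathCost D x0 w v p ω ∂μ =
      baseCost D x0 w v μ + ∑ k ∈ Finset.range D.N, stageExcess D x0 w v μ p k := by
  have hi0 : Integrable (fun ω => costToGo D 0 (x0 ω) +
      D.xref D.N ⬝ᵥ (D.Q D.N *ᵥ D.xref D.N)) μ :=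
    ((integrable_quadForm (K D 0) h.memLp_x0).fun_add
      ((integrable_dotProduct (memLp_const (g D 0)) h.memLp_x0).const_mul 2)).fun_add
      (integrable_const _)
  have hstage := fun k (hk : k ∈ Finset.range D.N) =>
    h.integral_stage hp hu (Finset.mem_range.1 hk)
      (transpose_eq_of_posDef (posDef_controlWeight D hQ hR (Finset.mem_range.1 hk)))
  have hi := integrable_finsetSum _ fun k hk => (hstage k hk).1
  rw [show pathCost D x0 w v p = _ from funext fun ω => pathCost_eq hQ hR ω]
  refine ⟨hi0.fun_add hi, ?_⟩
  rw [integral_add hi0 hi, integral_finsetSum _ fun k hk => (hstage k hk).1, baseCost, add_assoc,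
    ← Finset.sum_add_distrib]
  congr 1
  refine Finset.sum_congr rfl fun k hk => ?_
  rw [(hstage k hk).2]
  ring

/-! ### Lower bound, existence and characterisation of optimal policies. -/

section Optimality

variable {n m s : ℕ} {Ω : Type*} {mΩ : MeasurableSpace Ω} {D : Data n m s} {x0 : Ω → Fin n → ℝ}
  {w : ℕ → Ω → Fin n → ℝ} {v : ℕ → Ω → Fin s → ℝ} {μ : Measure Ω} {p : Policy m s}

theorem quadForm_nonneg {ι : Type*} [Fintype ι] {S : Matrix ι ι ℝ} (hS : S.PosDef) (x : ι → ℝ) :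
    0 ≤ x ⬝ᵥ (S *ᵥ x) := by
  simpa using hS.posSemidef.dotProduct_mulVec_nonneg x

theorem measurable_quadForm {ι α : Type*} [Fintype ι] {_ : MeasurableSpace α} (M : Matrix ι ι ℝ)
    {f : α → ι → ℝ} (hf : Measurable f) : Measurable fun a => f a ⬝ᵥ (M *ᵥ f a) :=
  Finset.measurable_fun_sum _ fun i _ => ((measurable_pi_apply i).comp hf).mul
    ((measurable_pi_apply i).comp (measurable_mulVec M hf))

theorem IsNoise.measurable_pathCost (h : IsNoise D x0 w v μ) (hp : Admissible D.N p) :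
    Measurable (pathCost D x0 w v p) := by
  refine Measurable.add (measurable_quadForm _ ((h.measurable_state hp le_rfl).sub_const _))
    (Finset.measurable_fun_sum _ fun k hk => ?_)
  have hk := Finset.mem_range.1 hk
  exact (measurable_quadForm _ ((h.measurable_state hp hk.le).sub_const _)).add
    (measurable_quadForm _ (h.measurable_control hp hk))

theorem quadForm_control_le_pathCost (hQ : ∀ k ≤ D.N, (D.Q k).PosDef)
    (hR : ∀ k < D.N, (D.R k).PosDef) {k : ℕ} (hk : k < D.N) (ω : Ω) :
    control D x0 w v p k ω ⬝ᵥ (D.R k *ᵥ control D x0 w v p k ω) ≤ pathCost D x0 w v p ω := by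
  have h1 := Finset.single_le_sum (f := fun k =>
      (state D x0 w v p k ω - D.xref k) ⬝ᵥ (D.Q k *ᵥ (state D x0 w v p k ω - D.xref k)) +
        control D x0 w v p k ω ⬝ᵥ (D.R k *ᵥ control D x0 w v p k ω))
    (fun j hj => add_nonneg (quadForm_nonneg (hQ j (Finset.mem_range.1 hj).le) _)
      (quadForm_nonneg (hR j (Finset.mem_range.1 hj)) _)) (Finset.mem_range.2 hk)
  have h2 := quadForm_nonneg (hQ k hk.le) (state D x0 w v p k ω - D.xref k)
  have h3 := quadForm_nonneg (hQ D.N le_rfl) (state D x0 w v p D.N ω - D.xref D.N)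
  simp only [pathCost]
  linarith

theorem pathCost_nonneg (hQ : ∀ k ≤ D.N, (D.Q k).PosDef) (hR : ∀ k < D.N, (D.R k).PosDef)
    (ω : Ω) : 0 ≤ pathCost D x0 w v p ω :=
  add_nonneg (quadForm_nonneg (hQ _ le_rfl) _) (Finset.sum_nonneg fun j hj =>
    add_nonneg (quadForm_nonneg (hQ j (Finset.mem_range.1 hj).le) _)
      (quadForm_nonneg (hR j (Finset.mem_range.1 hj)) _))

/-- A policy of finite cost has square-integrable controls. -/
theorem IsNoise.memLp_control_of_cost_lt_top (h : IsNoise D x0 w v μ)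
    (hQ : ∀ k ≤ D.N, (D.Q k).PosDef) (hR : ∀ k < D.N, (D.R k).PosDef) (hp : Admissible D.N p)
    (hcost : cost D x0 w v p μ < ∞) {k : ℕ} (hk : k < D.N) :
    MemLp (control D x0 w v p k) 2 μ := by
  have hint : Integrable (pathCost D x0 w v p) μ :=
    (lintegral_ofReal_ne_top_iff_integrable (h.measurable_pathCost hp).aestronglyMeasurable
      (ae_of_all _ (pathCost_nonneg hQ hR))).1 hcost.ne
  have hu := h.measurable_control hp hk
  refine memLp_two_of_integrable_quadForm (hR k hk) hu
    (hint.mono' (measurable_quadForm _ hu).aestronglyMeasurable (ae_of_all _ fun ω => ?_))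
  rw [Real.norm_of_nonneg (quadForm_nonneg (hR k hk) _)]
  exact quadForm_control_le_pathCost hQ hR hk ω

theorem stageExcess_nonneg {k : ℕ} (hM : (controlWeight D k).PosDef) :
    0 ≤ stageExcess D x0 w v μ p k :=
  integral_nonneg fun _ => quadForm_nonneg hM _

theorem stageExcess_eq_zero {k : ℕ} (hfb : ∀ᵐ ω ∂μ, control D x0 w v p k ω =
    feedback D k ((μ[state D x0 w v p k | infoSigma D x0 w v p k]) ω)) :
    stageExcess D x0 w v μ p k = 0 := by
  refine integral_eq_zero_of_ae ?_
  filter_upwards [hfb] with ω hω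
  rw [deviation, hω, sub_self, zero_dotProduct, Pi.zero_apply]

variable [IsProbabilityMeasure μ]

theorem IsNoise.cost_eq (h : IsNoise D x0 w v μ)
    (hQ : ∀ k ≤ D.N, (D.Q k).PosDef) (hR : ∀ k < D.N, (D.R k).PosDef) (hp : Admissible D.N p)
    (hu : ∀ k < D.N, MemLp (control D x0 w v p k) 2 μ) :
    cost D x0 w v p μ = ENNReal.ofReal (baseCost D x0 w v μ +
      ∑ k ∈ Finset.range D.N, stageExcess D x0 w v μ p k) := by
  obtain ⟨hi, heq⟩ := h.integral_pathCost hQ hR hp hu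
  rw [← heq, cost, ofReal_integral_eq_lintegral_ofReal hi (ae_of_all _ (pathCost_nonneg hQ hR))]

theorem IsNoise.ofReal_baseCost_le_cost (h : IsNoise D x0 w v μ)
    (hQ : ∀ k ≤ D.N, (D.Q k).PosDef) (hR : ∀ k < D.N, (D.R k).PosDef) (hp : Admissible D.N p) :
    ENNReal.ofReal (baseCost D x0 w v μ) ≤ cost D x0 w v p μ := by
  rcases eq_or_ne (cost D x0 w v p μ) ∞ with htop | hfin
  · rw [htop]; exact le_top
  · rw [h.cost_eq hQ hR hp fun k hk =>
      h.memLp_control_of_cost_lt_top hQ hR hp hfin.lt_top hk]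
    exact ENNReal.ofReal_le_ofReal (le_add_of_nonneg_right (Finset.sum_nonneg fun k hk =>
      stageExcess_nonneg (posDef_controlWeight D hQ hR (Finset.mem_range.1 hk))))

/-- Finiteness of the cost is not known here. Instead, square-integrability passes from earlier
controls to the state, to its conditional expectation, and through the affine feedback to the next
control. -/
theorem IsNoise.memLp_control_of_feedback (h : IsNoise D x0 w v μ)
    (hfb : ∀ k < D.N, ∀ᵐ ω ∂μ, control D x0 w v p k ω =
      feedback D k ((μ[state D x0 w v p k | infoSigma D x0 w v p k]) ω)) :
    ∀ k < D.N, MemLp (control D x0 w v p k) 2 μ := by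
  intro k
  induction k using Nat.strong_induction_on with
  | _ k ih =>
    intro hk
    have hx := h.memLp_state hk.le fun j hj => ih j hj (hj.trans hk)
    exact (memLp_feedback k (hx.condExp one_le_two)).ae_eq
      ((hfb k hk).mono fun ω hω => hω.symm)

theorem IsNoise.cost_eq_of_feedback (h : IsNoise D x0 w v μ)
    (hQ : ∀ k ≤ D.N, (D.Q k).PosDef) (hR : ∀ k < D.N, (D.R k).PosDef) (hp : Admissible D.N p)
    (hfb : ∀ k < D.N, ∀ᵐ ω ∂μ, control D x0 w v p k ω =
      feedback D k ((μ[state D x0 w v p k | infoSigma D x0 w v p k]) ω)) :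
    cost D x0 w v p μ = ENNReal.ofReal (baseCost D x0 w v μ) := by
  rw [h.cost_eq hQ hR hp (h.memLp_control_of_feedback hfb), Finset.sum_eq_zero, add_zero]
  exact fun k hk => stageExcess_eq_zero (hfb k (Finset.mem_range.1 hk))

theorem IsNoise.isOptimal_of_feedback (h : IsNoise D x0 w v μ)
    (hQ : ∀ k ≤ D.N, (D.Q k).PosDef) (hR : ∀ k < D.N, (D.R k).PosDef) (hp : Admissible D.N p)
    (hfb : ∀ k < D.N, ∀ᵐ ω ∂μ, control D x0 w v p k ω =
      feedback D k ((μ[state D x0 w v p k | infoSigma D x0 w v p k]) ω)) :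
    IsOptimal D x0 w v μ p :=
  ⟨hp, fun q hq => by
    rw [h.cost_eq_of_feedback hQ hR hp hfb]
    exact h.ofReal_baseCost_le_cost hQ hR hq⟩

/-- There is an admissible policy that realises the certainty-equivalent feedback. -/
theorem IsNoise.exists_feedback_policy (h : IsNoise D x0 w v μ) :
    ∃ p : Policy m s, Admissible D.N p ∧ ∀ k < D.N, ∀ᵐ ω ∂μ, control D x0 w v p k ω =
      feedback D k ((μ[state D x0 w v p k | infoSigma D x0 w v p k]) ω) := by
  -- Doob–Dynkin factorisation of the uncontrolled estimate, which exists before any policy is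
  -- chosen and so avoids circularity.
  have hφ : ∀ k, ∃ φ : Info m s k → Fin n → ℝ, Measurable φ ∧
      μ[state D x0 w v 0 k | infoSigma D x0 w v 0 k] = φ ∘ info D x0 w v 0 k := fun k =>
    stronglyMeasurable_condExp.measurable.exists_eq_measurable_comp
  choose φ hφm hφ using hφ
  -- The estimate is computed from the information stripped of past controls and then shifted by
  -- their drift.
  let p : Policy m s := fun k I =>
    feedback D k (φ k (freeInfo D I) + drift D (pastControls I) k)
  have hp : Admissible D.N p := fun k _ => measurable_feedback k
    (((hφm k).comp (measurable_freeInfo D k)).add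
      (measurable_drift fun j _ => measurable_pastControls k j))
  have hcontrol : ∀ k ω, control D x0 w v p k ω =
      feedback D k ((μ[state D x0 w v 0 k | infoSigma D x0 w v 0 k]) ω +
        drift D (fun j => control D x0 w v p j ω) k) := fun k ω => by
    rw [hφ, Function.comp_apply, ← freeInfo_info D x0 w v p k ω,
      ← drift_pastControls_info D x0 w v p le_rfl ω]
    rfl
  -- `hcontrol` involves only the uncontrolled estimate, so integrability can be obtained before
  -- `IsNoise.condExp_state`, which requires it.
  have hu : ∀ k < D.N, MemLp (control D x0 w v p k) 2 μ := by
    intro k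
    induction k using Nat.strong_induction_on with
    | _ k ih =>
      intro hk
      have h0 := h.memLp_state (p := 0) hk.le fun j _ => memLp_zero_control j
      have hd := memLp_drift fun j hj => ih j hj (hj.trans hk)
      rw [show control D x0 w v p k = _ from funext (hcontrol k)]
      exact memLp_feedback k (memLp_fun_add (h0.condExp one_le_two) hd)
  refine ⟨p, hp, fun k hk => ?_⟩
  filter_upwards [h.condExp_state hp hk fun j hj => hu j (hj.trans hk)] with ω hω
  rw [hω, ← hcontrol]

/-- Nonnegative excesses with sum at most zero all vanish, and positive definiteness of the control
weight then forces each deviation to be zero almost surely. -/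
theorem IsNoise.feedback_of_cost_le (h : IsNoise D x0 w v μ)
    (hQ : ∀ k ≤ D.N, (D.Q k).PosDef) (hR : ∀ k < D.N, (D.R k).PosDef) (hp : Admissible D.N p)
    (hcost : cost D x0 w v p μ ≤ ENNReal.ofReal (baseCost D x0 w v μ))
    (hbase : 0 ≤ baseCost D x0 w v μ) :
    ∀ k < D.N, ∀ᵐ ω ∂μ, control D x0 w v p k ω =
      feedback D k ((μ[state D x0 w v p k | infoSigma D x0 w v p k]) ω) := by
  have hu : ∀ k < D.N, MemLp (control D x0 w v p k) 2 μ := fun k hk =>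
    h.memLp_control_of_cost_lt_top hQ hR hp (hcost.trans_lt ENNReal.ofReal_lt_top) hk
  have hnn : ∀ k ∈ Finset.range D.N, 0 ≤ stageExcess D x0 w v μ p k := fun k hk =>
    stageExcess_nonneg (posDef_controlWeight D hQ hR (Finset.mem_range.1 hk))
  rw [h.cost_eq hQ hR hp hu, ENNReal.ofReal_le_ofReal_iff hbase] at hcost
  have hsum : ∑ k ∈ Finset.range D.N, stageExcess D x0 w v μ p k = 0 :=
    le_antisymm (by linarith) (Finset.sum_nonneg hnn)
  intro k hk
  have hM := posDef_controlWeight D hQ hR hk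
  have hzero := (Finset.sum_eq_zero_iff_of_nonneg hnn).1 hsum k (Finset.mem_range.2 hk)
  rw [stageExcess, integral_eq_zero_iff_of_nonneg (fun _ => quadForm_nonneg hM _)
    (integrable_quadForm _ (h.memLp_deviation hu hk))] at hzero
  filter_upwards [hzero] with ω hω
  by_contra hne
  have := hM.dotProduct_mulVec_pos (x := deviation D x0 w v μ p k ω) (sub_ne_zero.2 hne)
  rw [star_trivial] at this
  exact this.ne' hω

/-- The sign is not visible from the definition, since `costToGo` and `stageConst` may be negative;
but `baseCost` is the expected path cost of the feedback policy. This permits cancelling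
`ENNReal.ofReal` when costs are compared. -/
theorem IsNoise.baseCost_nonneg (h : IsNoise D x0 w v μ)
    (hQ : ∀ k ≤ D.N, (D.Q k).PosDef) (hR : ∀ k < D.N, (D.R k).PosDef) :
    0 ≤ baseCost D x0 w v μ := by
  obtain ⟨p, hp, hfb⟩ := h.exists_feedback_policy
  have heq := (h.integral_pathCost hQ hR hp (h.memLp_control_of_feedback hfb)).2
  have hzero : ∑ k ∈ Finset.range D.N, stageExcess D x0 w v μ p k = 0 :=
    Finset.sum_eq_zero fun k hk => stageExcess_eq_zero (hfb k (Finset.mem_range.1 hk))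
  rw [hzero, add_zero] at heq
  rw [← heq]
  exact integral_nonneg (pathCost_nonneg hQ hR)

end Optimality

end LQGTracking

theorem mainTheorem1 {n m s : ℕ} (D : LQGTracking.Data n m s)
    (hQ : ∀ k ≤ D.N, (D.Q k).PosDef) (hR : ∀ k < D.N, (D.R k).PosDef)
    {Ω : Type*} [MeasurableSpace Ω] (μ : Measure Ω) [IsProbabilityMeasure μ]
    (x0 : Ω → Fin n → ℝ) (w : ℕ → Ω → Fin n → ℝ) (v : ℕ → Ω → Fin s → ℝ)
    (hx0 : Measurable x0) (hw : ∀ k < D.N, Measurable (w k)) (hv : ∀ k < D.N, Measurable (v k))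
    (hx0_sq : MemLp x0 2 μ)
    (hw_sq : ∀ k < D.N, MemLp (w k) 2 μ) (hw_mean : ∀ k < D.N, ∫ ω, w k ω ∂μ = 0)
    (hw_indep : iIndepFun (fun k : Fin D.N => w k) μ)
    (hx0w_indep : IndepFun x0 (fun ω (k : Fin D.N) => w k ω) μ)
    (hv_indep : iIndepFun (fun k : Fin D.N => v k) μ)
    (hv_indep' : IndepFun (fun ω (k : Fin D.N) => v k ω)
      (fun ω => (x0 ω, fun k : Fin D.N => w k ω)) μ) :
    (∀ k < D.N, (D.R k + (D.B k)ᵀ * LQGTracking.K D (k + 1) * D.B k).PosDef) ∧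
    (∃ p : LQGTracking.Policy m s, LQGTracking.IsOptimal D x0 w v μ p ∧
      LQGTracking.cost D x0 w v p μ < ∞) ∧
    ∀ p : LQGTracking.Policy m s, LQGTracking.Admissible D.N p →
      (LQGTracking.IsOptimal D x0 w v μ p ↔
        ∀ k < D.N, ∀ᵐ ω ∂μ, LQGTracking.control D x0 w v p k ω =
          LQGTracking.feedback D k
            ((μ[LQGTracking.state D x0 w v p k | LQGTracking.infoSigma D x0 w v p k]) ω)) := by
  have h : LQGTracking.IsNoise D x0 w v μ :=
    ⟨hx0, hw, hv, hx0_sq, hw_sq, hw_mean, hw_indep, hx0w_indep, hv_indep'⟩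
  obtain ⟨p, hp, hfb⟩ := h.exists_feedback_policy
  have hopt := h.isOptimal_of_feedback hQ hR hp hfb
  have hcost := h.cost_eq_of_feedback hQ hR hp hfb
  refine ⟨fun k hk => LQGTracking.posDef_controlWeight D hQ hR hk,
    ⟨p, hopt, hcost ▸ ENNReal.ofReal_lt_top⟩, fun q hq =>
    ⟨fun hq' => h.feedback_of_cost_le hQ hR hq ?_ (h.baseCost_nonneg hQ hR),
      h.isOptimal_of_feedback hQ hR hq⟩⟩
  rw [← hcost]
  exact hq'.2 p hp
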